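/- **Theorem 2.1.** Let $\Omega\subset\mathbb{R}^n$ be a bounded, strictly convex domain (open, nonempty, with $\overline\Omega$ strictly convex) of diameter $D$ with smooth boundary, with outward unit normal $\nu$, and let $X$ be a time-dependent vector field on $\Omega$. Write $\mathbb{R}_+=[0,\infty)$. Suppose $v$ is a real function, smooth on $\overline\Omega\times\mathbb{R}_+$, which solves $$\frac{\partial v}{\partial t}=\Delta v+X\cdot\nabla v\quad\text{in }\Omega\times\mathbb{R}_+,\qquad D_\nu v=0\quad\text{on }\partial\Omega\times\mathbb{R}_+ .$$ A function $\eta$ is called a *modulus of continuity* for $f:\Omega\to\mathbb{R}$ if $|f(y)-f(x)|\le 2\eta\big(\tfrac{|y-x|}{2}\big)$ for all $x,y\in\Omega$; a function $\omega$ is called a *modulus of contraction* for a vector field $Y$ on $\Omega$ if $(Y(y)-Y(x))\cdot\frac{y-x}{|y-x|}\le 2\omega\big(\tfrac{|y-x|}{2}\big)$ for all $x\ne y$ in $\Omega$. Primes denote derivatives in $z\in[0,D/2]$; derivatives at end points of $[0,D/2]$ and at $t=0$ are one-sided. Suppose that 1. $X(\cdot,t)$ has modulus of contraction $\omega(\cdot,t)$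 for each $t\ge 0$, where $\omega:[0,D/2]\times\mathbb{R}_+\to\mathbb{R}$ is smooth; 2. $v(\cdot,0)$ has modulus of continuity $\varphi_0$, where $\varphi_0:[0,D/2]\to\mathbb{R}$ is smooth with $\varphi_0(0)=0$ and $\varphi_0'(z)>0$ for $0\le z\le D/2$; 3. $\varphi:[0,D/2]\times\mathbb{R}_+\to\mathbb{R}$ is differentiable in $t$ and twice differentiable in $z$, and satisfies (i) $\varphi(z,0)=\varphi_0(z)$ for each $z\in[0,D/2]$; (ii) $\frac{\partial\varphi}{\partial t}\ge\varphi''+\omega\varphi'$ on $[0,D/2]\times\mathbb{R}_+$; (iii) $\varphi'>0$ on $[0,D/2]\times\mathbb{R}_+$; (iv) $\varphi(0,t)\ge 0$ for each $t\ge 0$. Then $\varphi(\cdot,t)$ is a modulus of continuity for $v(\cdot,t)$ for each $t\ge 0$. -/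

import Mathlib

open Set Filter Topology

/-- `η` is a modulus of continuity for `f` on `Ω`. -/
def IsModulusOfContinuity {n : ℕ} (Ω : Set (EuclideanSpace ℝ (Fin n))) (η : ℝ → ℝ)
    (f : EuclideanSpace ℝ (Fin n) → ℝ) : Prop :=
  ∀ x ∈ Ω, ∀ y ∈ Ω, |f y - f x| ≤ 2 * η (‖y - x‖ / 2)

/-- `ω` is a modulus of expansion for the vector field `X` on `Ω`. -/
def IsModulusOfExpansion {n : ℕ} (Ω : Set (EuclideanSpace ℝ (Fin n))) (ω : ℝ → ℝ)
    (X : EuclideanSpace ℝ (Fin n) → EuclideanSpace ℝ (Fin n)) : Prop :=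
  ∀ x ∈ Ω, ∀ y ∈ Ω, y ≠ x →
    2 * ω (‖y - x‖ / 2) ≤ inner ℝ (X y - X x) (‖y - x‖⁻¹ • (y - x))

/-- `ω` is a modulus of contraction for the vector field `X` on `Ω`: the inequality for a modulus
of expansion with its sign reversed. -/
def IsModulusOfContraction {n : ℕ} (Ω : Set (EuclideanSpace ℝ (Fin n))) (ω : ℝ → ℝ)
    (X : EuclideanSpace ℝ (Fin n) → EuclideanSpace ℝ (Fin n)) : Prop :=
  IsModulusOfExpansion Ω (fun z => -ω z) (fun x => -X x)

/-- `ρ` is a smooth local defining function of `Ω` at `p`: near `p`, the set `Ω` is the sublevel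
set `{ρ < 0}`, and `p` is not a critical point of `ρ`. (That `ρ` is defined and smooth on the
whole space is no restriction, by multiplying with a cut-off function.) -/
structure IsDefiningFunctionAt {n : ℕ} (Ω : Set (EuclideanSpace ℝ (Fin n)))
    (p : EuclideanSpace ℝ (Fin n)) (ρ : EuclideanSpace ℝ (Fin n) → ℝ) : Prop where
  smooth : ContDiff ℝ (⊤ : ℕ∞) ρ
  gradient_ne_zero : gradient ρ p ≠ 0
  mem_iff : ∀ᶠ x in 𝓝 p, (x ∈ Ω ↔ ρ x < 0)

/-- The open set `Ω` has smooth boundary. -/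
def HasSmoothBoundary {n : ℕ} (Ω : Set (EuclideanSpace ℝ (Fin n))) : Prop :=
  ∀ p ∈ frontier Ω, ∃ ρ, IsDefiningFunctionAt Ω p ρ

/-- `ν` is the outward unit normal to `∂Ω` at the boundary point `p`. -/
def IsOutwardUnitNormal {n : ℕ} (Ω : Set (EuclideanSpace ℝ (Fin n)))
    (p ν : EuclideanSpace ℝ (Fin n)) : Prop :=
  p ∈ frontier Ω ∧ ∃ ρ, IsDefiningFunctionAt Ω p ρ ∧ ν = ‖gradient ρ p‖⁻¹ • gradient ρ p

/-- A strictly convex domain. For an open set, `StrictConvex` is the same as convexity; strict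
convexity of the domain (no line segments in the boundary) is `StrictConvex` of its closure. -/
structure IsStrictlyConvexDomain {n : ℕ} (Ω : Set (EuclideanSpace ℝ (Fin n))) : Prop where
  isOpen : IsOpen Ω
  nonempty : Ω.Nonempty
  convex : Convex ℝ Ω
  strictConvex_closure : StrictConvex ℝ (closure Ω)

/-- `v x t` is a smooth solution (up to the boundary and up to `t = 0`) of the Neumann heat
equation with drift `X`,
`∂v/∂t = Δv + X · ∇v` in `Ω × [0, ∞)` and `D_ν v = 0` on `∂Ω × [0, ∞)`. -/
structure IsNeumannDriftSolution {n : ℕ} (Ω : Set (EuclideanSpace ℝ (Fin n)))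
    (X : EuclideanSpace ℝ (Fin n) → ℝ → EuclideanSpace ℝ (Fin n))
    (v : EuclideanSpace ℝ (Fin n) → ℝ → ℝ) : Prop where
  smooth : ContDiffOn ℝ (⊤ : ℕ∞) (fun p : EuclideanSpace ℝ (Fin n) × ℝ => v p.1 p.2)
    (closure Ω ×ˢ Ici 0)
  equation : ∀ x ∈ Ω, ∀ t : ℝ, 0 ≤ t →
    derivWithin (fun s => v x s) (Ici 0) t =
      Laplacian.laplacian (fun y => v y t) x + inner ℝ (X x t) (gradient (fun y => v y t) x)
  neumann : ∀ p ν, IsOutwardUnitNormal Ω p ν → ∀ t : ℝ, 0 ≤ t →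
    fderivWithin ℝ (fun y => v y t) (closure Ω) p ν = 0

/-- The derivative `f'` of a function on the interval `[0, b]`, one-sided at the end points. -/
noncomputable def derivIcc (b : ℝ) (f : ℝ → ℝ) (z : ℝ) : ℝ :=
  derivWithin f (Icc 0 b) z

/-!
The proof is the maximum principle for the two-point function
`v (y, t) - v (x, t) - 2 φ (|y - x| / 2, t) - ε (1 + t)` on `closure Ω × closure Ω`, for `ε > 0`.
It is negative at `t = 0`, where `φ` is the given modulus of continuity, and always negative on
the diagonal, because `φ (0, t) ≥ 0`. If it is ever nonnegative, there is a first time `t > 0`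
at which its maximum is zero (`exists_first_zero`), attained at some `x ≠ y`. Existence of a first
time needs joint continuity of `φ`, which is only assumed separately regular; it follows from
monotonicity in `z` (`continuousOn_uncurry_of_monotoneOn`).

The maximum is not on the boundary: if `y ∈ ∂Ω`, moving `y` along the inward normal does not
change `v` to first order by the Neumann condition, but by strict convexity decreases `|y - x|` to
first order, hence increases the two-point function because `φ' > 0`
(`IsStrictlyConvexDomain.not_isMaxOn_sub_of_neumann`).

At an interior maximum let `e = (y - x) / |y - x|`. The first-order conditions give
`∇v (y) = ∇v (x) = φ' e` (`fderiv_eq_of_isMaxOn_two_point`), so that the modulus of contraction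
bounds the difference of the drift terms by `2 ω φ'`. The second variation along `(-e, e)` and
along `(w, w)` for `w` orthogonal to `e` gives `Δv (y) - Δv (x) ≤ 2 φ''`
(`laplacian_sub_le_of_isMaxOn_two_point`). By the differential inequality for `φ`, the time
derivative of the two-point function is then at most `-ε`, whereas it is nonnegative at a first
zero. Finally `ε → 0`.
-/

/-! ### Calculus on the real line -/

/-- A function of two variables that is monotone in the first and separately continuous is jointly
continuous. -/
theorem continuousOn_uncurry_of_monotoneOn {S : Set ℝ} {T : Type*} [TopologicalSpace T]
    {J : Set T} {φ : ℝ → T → ℝ} (hmono : ∀ t ∈ J, MonotoneOn (fun z => φ z t) S)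
    (hz : ∀ t ∈ J, ContinuousOn (fun z => φ z t) S)
    (ht : ∀ z ∈ S, ContinuousOn (fun t => φ z t) J) :
    ContinuousOn (fun p : ℝ × T => φ p.1 p.2) (S ×ˢ J) := by
  rintro ⟨z₀, t₀⟩ ⟨hz₀, ht₀⟩
  rw [ContinuousWithinAt, tendsto_order, nhdsWithin_prod_eq]
  have hc := tendsto_order.1 (hz t₀ ht₀ z₀ hz₀)
  refine ⟨fun a ha => ?_, fun a ha => ?_⟩
  · obtain ⟨z₁, hz₁, ha₁, hev⟩ : ∃ z₁ ∈ S, a < φ z₁ t₀ ∧ ∀ᶠ z in 𝓝[S] z₀, z₁ ≤ z := by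
      by_cases h : ∃ᶠ z in 𝓝[S] z₀, z < z₀
      · obtain ⟨z₁, hlt, haz, hzS⟩ :=
          (h.and_eventually ((hc.1 a ha).and self_mem_nhdsWithin)).exists
        exact ⟨z₁, hzS, haz, nhdsWithin_le_nhds (eventually_ge_nhds hlt)⟩
      · exact ⟨z₀, hz₀, ha, by simpa [not_frequently] using h⟩
    have ht₁ := (tendsto_order.1 (ht z₁ hz₁ t₀ ht₀)).1 a ha₁
    filter_upwards [(hev.and self_mem_nhdsWithin).prod_mk (ht₁.and self_mem_nhdsWithin)]
      with p hp
    exact hp.2.1.trans_le (hmono p.2 hp.2.2 hz₁ hp.1.2 hp.1.1)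
  · obtain ⟨z₁, hz₁, ha₁, hev⟩ : ∃ z₁ ∈ S, φ z₁ t₀ < a ∧ ∀ᶠ z in 𝓝[S] z₀, z ≤ z₁ := by
      by_cases h : ∃ᶠ z in 𝓝[S] z₀, z₀ < z
      · obtain ⟨z₁, hlt, haz, hzS⟩ :=
          (h.and_eventually ((hc.2 a ha).and self_mem_nhdsWithin)).exists
        exact ⟨z₁, hzS, haz, nhdsWithin_le_nhds (eventually_le_nhds hlt)⟩
      · exact ⟨z₀, hz₀, ha, by simpa [not_frequently] using h⟩
    have ht₁ := (tendsto_order.1 (ht z₁ hz₁ t₀ ht₀)).2 a ha₁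
    filter_upwards [(hev.and self_mem_nhdsWithin).prod_mk (ht₁.and self_mem_nhdsWithin)]
      with p hp
    exact (hmono p.2 hp.2.2 hp.1.2 hz₁ hp.1.1).trans_lt hp.2.1

theorem monotoneOn_Icc_of_derivIcc_pos {b : ℝ} {f : ℝ → ℝ}
    (hf : DifferentiableOn ℝ f (Icc 0 b)) (hpos : ∀ z ∈ Icc 0 b, 0 < derivIcc b f z) :
    MonotoneOn f (Icc 0 b) := by
  refine (strictMonoOn_of_deriv_pos (convex_Icc 0 b) hf.continuousOn fun z hz => ?_).monotoneOn
  rw [interior_Icc] at hz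
  have := hpos z (Ioo_subset_Icc_self hz)
  rwa [derivIcc, derivWithin_of_mem_nhds (Icc_mem_nhds hz.1 hz.2)] at this

/-- The second derivative is nonpositive at an interior local maximum. -/
theorem IsLocalMax.second_deriv_nonpos {g g' : ℝ → ℝ} {g'' a : ℝ} (hmax : IsLocalMax g a)
    (h₁ : ∀ᶠ s in 𝓝 a, HasDerivAt g (g' s) s) (h₂ : HasDerivAt g' g'' a) : g'' ≤ 0 := by
  by_contra! hpos
  have heq : deriv g =ᶠ[𝓝 a] g' := h₁.mono fun s hs => hs.deriv
  have hmin : IsLocalMin g a := by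
    refine isLocalMin_of_deriv_deriv_pos ?_ hmax.deriv_eq_zero h₁.self_of_nhds.continuousAt
    rwa [heq.deriv_eq, h₂.deriv]
  -- a local maximum that is also a local minimum makes `g` locally constant
  have hconst : g =ᶠ[𝓝 a] fun _ => g a := by
    filter_upwards [hmax, hmin] with s hs hs' using le_antisymm hs hs'
  have hzero : g' =ᶠ[𝓝 a] fun _ => 0 := by
    filter_upwards [hconst.eventuallyEq_nhds, h₁] with s hs hs'
    rw [← hs'.deriv, hs.deriv_eq, deriv_const]
  have := h₂.deriv
  rw [hzero.deriv_eq, deriv_const] at this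
  exact hpos.ne this

theorem hasDerivAt_nonneg_of_forall_le_left {g : ℝ → ℝ} {g' t₀ : ℝ} (ht₀ : 0 < t₀)
    (hg : HasDerivAt g g' t₀) (hmax : ∀ t ∈ Icc 0 t₀, g t ≤ g t₀) : 0 ≤ g' := by
  have h : (0 : ℝ) - t₀ ∈ posTangentConeAt (Icc 0 t₀) t₀ :=
    sub_mem_posTangentConeAt_of_segment_subset
      ((convex_Icc 0 t₀).segment_subset (right_mem_Icc.2 ht₀.le) (left_mem_Icc.2 ht₀.le))
  have hmax' : IsLocalMaxOn g (Icc 0 t₀) t₀ := IsMaxOn.localize hmax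
  have := hmax'.hasFDerivWithinAt_nonpos hg.hasFDerivAt.hasFDerivWithinAt h
  simp only [ContinuousLinearMap.toSpanSingleton_apply, smul_eq_mul] at this
  nlinarith

/-! ### The distance function and restrictions to lines -/

section InnerProduct

variable {E : Type*} [NormedAddCommGroup E] [InnerProductSpace ℝ E]

theorem hasFDerivAt_half_norm_sub {p q : E} (h : p ≠ q) :
    HasFDerivAt (fun x => ‖x - q‖ / 2)
      ((1 / 2 : ℝ) • innerSL ℝ (‖p - q‖⁻¹ • (p - q))) p := by
  have hpos : 0 < ‖p - q‖ := norm_pos_iff.2 (sub_ne_zero.2 h)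
  have h₁ := (((hasFDerivAt_id p).sub_const q).norm_sq.sqrt (by positivity)).mul_const (1 / 2 : ℝ)
  refine (h₁.congr_fderiv ?_).congr_of_eventuallyEq (Eventually.of_forall fun x => ?_)
  · ext w
    simp [Real.sqrt_sq hpos.le]
    field_simp
  · simp [Real.sqrt_sq (norm_nonneg _)]
    ring

theorem ContDiffAt.hasDerivAt_along_line {f : E → ℝ} {y : E} (hf : ContDiffAt ℝ 2 f y) (w : E) :
    (∀ᶠ s : ℝ in 𝓝 0, HasDerivAt (fun s : ℝ => f (y + s • w)) (fderiv ℝ f (y + s • w) w) s) ∧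
      HasDerivAt (fun s : ℝ => fderiv ℝ f (y + s • w) w) (fderiv ℝ (fderiv ℝ f) y w w) 0 := by
  have hline : ∀ s : ℝ, HasDerivAt (fun s : ℝ => y + s • w) w s := fun s => by
    simpa using ((hasDerivAt_id s).smul_const w).const_add y
  constructor
  · have hd : ∀ᶠ p in 𝓝 y, DifferentiableAt ℝ f p :=
      (hf.eventually (by simp)).mono fun p hp => hp.differentiableAt (by simp)
    have ht : Tendsto (fun s : ℝ => y + s • w) (𝓝 0) (𝓝 y) := by
      simpa using (hline 0).continuousAt.tendsto
    exact (ht.eventually hd).mono fun s hs => hs.hasFDerivAt.comp_hasDerivAt s (hline s)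
  · have hd : DifferentiableAt ℝ (fderiv ℝ f) y :=
      (hf.fderiv_right (m := 1) (by norm_num)).differentiableAt (by simp)
    have hd' : HasFDerivAt (fderiv ℝ f) (fderiv ℝ (fderiv ℝ f) y) (y + (0 : ℝ) • w) := by
      simpa using hd.hasFDerivAt
    have hc : HasDerivAt (fun s : ℝ => fderiv ℝ f (y + s • w)) (fderiv ℝ (fderiv ℝ f) y w) 0 :=
      HasFDerivAt.comp_hasDerivAt (l := fderiv ℝ f) (0 : ℝ) hd' (hline 0)
    simpa using hc.clm_apply (hasDerivAt_const 0 w)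

/-- Two Laplacians compare as soon as the Hessians do so in one unit direction `e` and in all
directions orthogonal to it. -/
theorem laplacian_sub_laplacian_le [FiniteDimensional ℝ E] {f : E → ℝ} {x y e : E} {c : ℝ}
    (he : ‖e‖ = 1)
    (hlong : fderiv ℝ (fderiv ℝ f) y e e - fderiv ℝ (fderiv ℝ f) x e e ≤ c)
    (htrans : ∀ w : E, inner ℝ e w = 0 →
      fderiv ℝ (fderiv ℝ f) y w w ≤ fderiv ℝ (fderiv ℝ f) x w w) :
    Laplacian.laplacian f y - Laplacian.laplacian f x ≤ c := by
  classical
  have ho : Orthonormal ℝ ((↑) : ({e} : Set E) → E) := by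
    rw [orthonormal_subtype_iff_ite]
    rintro v rfl w rfl
    simp [he]
  obtain ⟨u, b, hu, hb⟩ := ho.exists_orthonormalBasis_extension
  have heu : e ∈ u := by simpa using hu
  have hbe : b ⟨e, heu⟩ = e := by rw [hb]
  rw [InnerProductSpace.laplacian_eq_iteratedFDeriv_orthonormalBasis f b]
  simp only [iteratedFDeriv_two_apply, Matrix.cons_val_zero, Matrix.cons_val_one]
  rw [← Finset.sum_sub_distrib, ← Finset.add_sum_erase _ _ (Finset.mem_univ ⟨e, heu⟩), hbe]
  have hle : ∑ i ∈ Finset.univ.erase ⟨e, heu⟩, (fderiv ℝ (fderiv ℝ f) y (b i) (b i)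
      - fderiv ℝ (fderiv ℝ f) x (b i) (b i)) ≤ 0 := by
    refine Finset.sum_nonpos fun i hi => ?_
    have : inner ℝ (b ⟨e, heu⟩) (b i) = 0 := b.orthonormal.2 (Finset.ne_of_mem_erase hi).symm
    rw [hbe] at this
    linarith [htrans _ this]
  linarith

/-! ### The two-point function at an interior maximum -/

/-- First-order conditions at an interior maximum: both gradients are `ψ'` times the unit vector
from `x` to `y`. -/
theorem fderiv_eq_of_isMaxOn_two_point {Ω : Set E} (hΩ : IsOpen Ω) {f : E → ℝ} {ψ : ℝ → ℝ}
    {x y : E} {ψ' : ℝ} (hxΩ : x ∈ Ω) (hyΩ : y ∈ Ω) (hxy : x ≠ y)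
    (hfx : DifferentiableAt ℝ f x) (hfy : DifferentiableAt ℝ f y)
    (hψ : HasDerivAt ψ ψ' (‖y - x‖ / 2))
    (hmax : ∀ x' ∈ Ω, ∀ y' ∈ Ω,
      f y' - f x' - 2 * ψ (‖y' - x'‖ / 2) ≤ f y - f x - 2 * ψ (‖y - x‖ / 2)) :
    (∀ w, fderiv ℝ f y w = ψ' * inner ℝ (‖y - x‖⁻¹ • (y - x)) w) ∧
      ∀ w, fderiv ℝ f x w = ψ' * inner ℝ (‖y - x‖⁻¹ • (y - x)) w := by
  constructor <;> intro w
  · have hd := hfy.hasFDerivAt.sub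
      ((hψ.comp_hasFDerivAt y (hasFDerivAt_half_norm_sub hxy.symm)).const_mul 2)
    have hloc : IsLocalMax (f - fun p => 2 * (ψ ∘ fun p => ‖p - x‖ / 2) p) y := by
      filter_upwards [hΩ.mem_nhds hyΩ] with p hp
      have := hmax x hxΩ p hp
      simp only [Pi.sub_apply, Function.comp]
      linarith
    have h := congr($(hloc.hasFDerivAt_eq_zero hd) w)
    simp [inner_sub_left, inner_smul_left] at h ⊢
    linarith
  · have hψ' : HasDerivAt ψ ψ' (‖x - y‖ / 2) := by rwa [norm_sub_rev]
    have hd := hfx.hasFDerivAt.add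
      ((hψ'.comp_hasFDerivAt x (hasFDerivAt_half_norm_sub hxy)).const_mul 2)
    have hloc : IsLocalMin (f + fun p => 2 * (ψ ∘ fun p => ‖p - y‖ / 2) p) x := by
      filter_upwards [hΩ.mem_nhds hxΩ] with p hp
      have := hmax p hp y hyΩ
      simp only [Pi.add_apply, Function.comp]
      rw [norm_sub_rev p, norm_sub_rev x]
      linarith
    have h := congr($(hloc.hasFDerivAt_eq_zero hd) w)
    rw [norm_sub_rev y x, ← neg_sub x y, smul_neg, inner_neg_left]
    simp [inner_sub_left, inner_smul_left] at h ⊢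
    linarith

/-- Second-order conditions at an interior maximum, from moving `x` and `y` apart at unit speed
and from translating both orthogonally to `y - x`. -/
theorem laplacian_sub_le_of_isMaxOn_two_point [FiniteDimensional ℝ E] {Ω : Set E}
    (hΩ : IsOpen Ω) {f : E → ℝ} {ψ ψ' : ℝ → ℝ} {ψ'' : ℝ} {x y : E}
    (hxΩ : x ∈ Ω) (hyΩ : y ∈ Ω) (hxy : x ≠ y)
    (hfx : ContDiffAt ℝ 2 f x) (hfy : ContDiffAt ℝ 2 f y)
    (hψ : ∀ᶠ z in 𝓝 (‖y - x‖ / 2), HasDerivAt ψ (ψ' z) z)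
    (hψ' : HasDerivAt ψ' ψ'' (‖y - x‖ / 2))
    (hmax : ∀ x' ∈ Ω, ∀ y' ∈ Ω,
      f y' - f x' - 2 * ψ (‖y' - x'‖ / 2) ≤ f y - f x - 2 * ψ (‖y - x‖ / 2)) :
    Laplacian.laplacian f y - Laplacian.laplacian f x ≤ 2 * ψ'' := by
  have hd : 0 < ‖y - x‖ := norm_pos_iff.2 (sub_ne_zero.2 hxy.symm)
  set d := ‖y - x‖ with hd_def
  set e := d⁻¹ • (y - x) with he_def
  have he : ‖e‖ = 1 := by
    rw [he_def, norm_smul, norm_inv, Real.norm_of_nonneg hd.le, ← hd_def, inv_mul_cancel₀ hd.ne']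
  have hde : y - x = d • e := by rw [he_def, smul_inv_smul₀ hd.ne']
  have hmem : ∀ {p : E}, p ∈ Ω → ∀ w : E, ∀ᶠ s : ℝ in 𝓝 0, p + s • w ∈ Ω := fun {p} hp w => by
    have : ContinuousAt (fun s : ℝ => p + s • w) 0 := by fun_prop
    exact this.eventually (hΩ.mem_nhds (by simpa using hp))
  refine laplacian_sub_laplacian_le he ?_ fun w hw => ?_
  · obtain ⟨hy₁, hy₂⟩ := hfy.hasDerivAt_along_line e
    obtain ⟨hx₁, hx₂⟩ := hfx.hasDerivAt_along_line (-e)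
    have hshift : Tendsto (fun s : ℝ => d / 2 + s) (𝓝 0) (𝓝 (d / 2)) := by
      have : ContinuousAt (fun s : ℝ => d / 2 + s) 0 := by fun_prop
      simpa using this.tendsto
    have hloc : IsLocalMax
        (fun s : ℝ => f (y + s • e) - f (x + s • -e) - 2 * ψ (d / 2 + s)) 0 := by
      filter_upwards [hmem hyΩ e, hmem hxΩ (-e), eventually_gt_nhds (neg_lt_zero.2 (half_pos hd))]
        with s h₁ h₂ h₃
      have hn : ‖y + s • e - (x + s • -e)‖ / 2 = d / 2 + s := by
        have : y + s • e - (x + s • -e) = (d + 2 * s) • e := by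
          rw [add_smul, ← hde, smul_neg, mul_smul, two_smul]; abel
        rw [this, norm_smul, he, Real.norm_of_nonneg (by linarith)]
        ring
      have := hmax _ h₂ _ h₁
      rw [hn] at this
      simpa using this
    have := hloc.second_deriv_nonpos
      (g' := fun s => fderiv ℝ f (y + s • e) e - fderiv ℝ f (x + s • -e) (-e)
        - 2 * ψ' (d / 2 + s))
      (by
        filter_upwards [hy₁, hx₁, hshift.eventually hψ] with s h₁ h₂ h₃
        exact (h₁.sub h₂).sub ((h₃.comp_const_add (d / 2) s).const_mul 2))
      ((hy₂.sub hx₂).sub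
        ((HasDerivAt.comp_const_add (d / 2) 0 (by simpa using hψ')).const_mul 2))
    simp only [map_neg, neg_apply, neg_neg] at this
    linarith
  · obtain ⟨hy₁, hy₂⟩ := hfy.hasDerivAt_along_line w
    obtain ⟨hx₁, hx₂⟩ := hfx.hasDerivAt_along_line w
    have hloc : IsLocalMax (fun s : ℝ => f (y + s • w) - f (x + s • w)) 0 := by
      filter_upwards [hmem hyΩ w, hmem hxΩ w] with s h₁ h₂
      have := hmax _ h₂ _ h₁
      rw [add_sub_add_right_eq_sub] at this
      simp only [zero_smul, add_zero]
      linarith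
    have := hloc.second_deriv_nonpos
      (by filter_upwards [hy₁, hx₁] with s h₁ h₂ using h₁.sub h₂) (hy₂.sub hx₂)
    linarith

end InnerProduct

/-! ### Outward normals of strictly convex domains -/

section Domain

variable {n : ℕ} {Ω : Set (EuclideanSpace ℝ (Fin n))}

theorem Convex.interior_closure_eq_of_isOpen (hΩ : Convex ℝ Ω) (ho : IsOpen Ω)
    (hne : Ω.Nonempty) : interior (closure Ω) = Ω := by
  rw [hΩ.interior_closure_eq_interior_of_nonempty_interior (by rwa [ho.interior_eq]),
    ho.interior_eq]

namespace IsDefiningFunctionAt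

variable {p : EuclideanSpace ℝ (Fin n)} {ρ : EuclideanSpace ℝ (Fin n) → ℝ}

theorem hasFDerivAt (hρ : IsDefiningFunctionAt Ω p ρ) : HasFDerivAt ρ (fderiv ℝ ρ p) p :=
  (hρ.smooth.differentiable (by simp) p).hasFDerivAt

theorem eq_zero (ho : IsOpen Ω) (hp : p ∈ frontier Ω) (hρ : IsDefiningFunctionAt Ω p ρ) :
    ρ p = 0 := by
  rw [ho.frontier_eq] at hp
  refine le_antisymm ?_ (not_lt.1 fun h => hp.2 (hρ.mem_iff.self_of_nhds.2 h))
  have hfreq : ∃ᶠ x in 𝓝 p, ρ x ≤ 0 :=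
    ((mem_closure_iff_frequently.1 hp.1).and_eventually hρ.mem_iff).mono
      fun x hx => (hx.2.1 hx.1).le
  exact le_of_tendsto_of_frequently hρ.smooth.continuous.continuousAt hfreq

end IsDefiningFunctionAt

/-- At a boundary point, the direction opposite to the outward normal is an inward direction. -/
theorem IsOutwardUnitNormal.neg_mem_posTangentConeAt (ho : IsOpen Ω)
    {p ν : EuclideanSpace ℝ (Fin n)} (hν : IsOutwardUnitNormal Ω p ν) :
    -ν ∈ posTangentConeAt (closure Ω) p := by
  obtain ⟨hp, ρ, hρ, rfl⟩ := hν
  set ν := ‖gradient ρ p‖⁻¹ • gradient ρ p with hν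
  have hline : HasDerivAt (fun s : ℝ => p + s • -ν) (-ν) 0 := by
    simpa using ((hasDerivAt_id (0 : ℝ)).smul_const (-ν)).const_add p
  have hd : HasDerivAt (fun s : ℝ => ρ (p + s • -ν)) (fderiv ℝ ρ p (-ν)) 0 :=
    HasFDerivAt.comp_hasDerivAt (l := ρ) (0 : ℝ) (by simpa using hρ.hasFDerivAt) hline
  have hneg : fderiv ℝ ρ p (-ν) < 0 := by
    have hpos : 0 < ‖gradient ρ p‖ := norm_pos_iff.2 hρ.gradient_ne_zero
    rw [← inner_gradient_left, inner_neg_right, hν, inner_smul_right, real_inner_self_eq_norm_sq]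
    have : 0 < ‖gradient ρ p‖⁻¹ * ‖gradient ρ p‖ ^ 2 := by positivity
    linarith
  have hlt : ∀ᶠ s : ℝ in 𝓝[>] 0, ρ (p + s • -ν) < 0 := by
    have hslope := (hasDerivAt_iff_tendsto_slope.1 hd).mono_left (nhdsGT_le_nhdsNE 0)
    filter_upwards [hslope.eventually (eventually_lt_nhds hneg), self_mem_nhdsWithin] with s hs hs0
    simp only [slope_def_field, zero_smul, add_zero, hρ.eq_zero ho hp, sub_zero] at hs
    exact (div_neg_iff.1 hs).resolve_left (fun h => lt_asymm h.2 hs0) |>.1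
  have ht : Tendsto (fun s : ℝ => p + s • -ν) (𝓝[>] 0) (𝓝 p) := by
    have := hline.continuousAt.tendsto
    simp only [zero_smul, add_zero] at this
    exact this.mono_left nhdsWithin_le_nhds
  refine mem_posTangentConeAt_of_frequently_mem (Eventually.frequently ?_)
  filter_upwards [hlt, ht.eventually hρ.mem_iff] with s h₁ h₂ using subset_closure (h₂.2 h₁)

/-- Strict convexity puts every other point of the closed domain strictly on the inner side of the
tangent hyperplane at a boundary point. -/
theorem IsStrictlyConvexDomain.inner_normal_pos (hΩ : IsStrictlyConvexDomain Ω)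
    {p q ν : EuclideanSpace ℝ (Fin n)} (hν : IsOutwardUnitNormal Ω p ν) (hq : q ∈ closure Ω)
    (hqp : q ≠ p) : 0 < inner ℝ (p - q) ν := by
  obtain ⟨hp, ρ, hρ, rfl⟩ := hν
  have hint := hΩ.convex.interior_closure_eq_of_isOpen hΩ.isOpen hΩ.nonempty
  have hpcl : p ∈ closure Ω := frontier_subset_closure hp
  have hmid : (1 / 2 : ℝ) • p + (1 / 2 : ℝ) • q ∈ Ω := hint ▸
    hΩ.strictConvex_closure hpcl hq hqp.symm (by norm_num) (by norm_num) (by norm_num)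
  set g := gradient ρ p with hg
  have hgpos : 0 < ‖g‖ := norm_pos_iff.2 hρ.gradient_ne_zero
  -- the midpoint of `p` and `q` is interior, so that it may be pushed a little along the gradient
  obtain ⟨s, hs, hspos⟩ : ∃ s : ℝ, (1 / 2 : ℝ) • p + (1 / 2 : ℝ) • q + s • g ∈ Ω ∧ 0 < s := by
    have hc : ContinuousAt (fun s : ℝ => (1 / 2 : ℝ) • p + (1 / 2 : ℝ) • q + s • g) 0 := by
      fun_prop
    have := hc.eventually (hΩ.isOpen.mem_nhds (by simpa using hmid))
    exact ((this.filter_mono (nhdsWithin_le_nhds (s := Ioi 0))).and self_mem_nhdsWithin).exists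
  set m := (1 / 2 : ℝ) • p + (1 / 2 : ℝ) • q + s • g with hm
  have hcone : m - p ∈ posTangentConeAt (insert p Ω) p := by
    refine sub_mem_posTangentConeAt_of_openSegment_subset ?_
    rw [openSegment_symm]
    have := hΩ.convex.openSegment_interior_closure_subset_interior
      (by rwa [hΩ.isOpen.interior_eq]) hpcl
    rw [hΩ.isOpen.interior_eq] at this
    exact this.trans (subset_insert _ _)
  have hmax : IsLocalMaxOn ρ (insert p Ω) p := by
    filter_upwards [nhdsWithin_le_nhds hρ.mem_iff, self_mem_nhdsWithin] with x hx hxm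
    rcases hxm with rfl | hxm
    · exact le_rfl
    · rw [hρ.eq_zero hΩ.isOpen hp]
      exact (hx.1 hxm).le
  have hle := hmax.hasFDerivWithinAt_nonpos hρ.hasFDerivAt.hasFDerivWithinAt hcone
  have hdecomp : m - p = -(1 / 2 : ℝ) • (p - q) + s • g := by
    rw [hm]; module
  rw [← inner_gradient_left, ← hg, hdecomp, inner_add_right, inner_smul_right, inner_smul_right,
    real_inner_self_eq_norm_sq, real_inner_comm] at hle
  rw [inner_smul_right]
  have hsg : 0 < s * ‖g‖ ^ 2 := by positivity
  exact mul_pos (inv_pos.2 hgpos) (by linarith)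

/-- A function with vanishing normal derivative, minus an increasing
function of the distance to `q`, has no maximum at a boundary point other than `q`. -/
theorem IsStrictlyConvexDomain.not_isMaxOn_sub_of_neumann (hΩ : IsStrictlyConvexDomain Ω)
    (hbdd : Bornology.IsBounded Ω) {p q ν : EuclideanSpace ℝ (Fin n)}
    (hν : IsOutwardUnitNormal Ω p ν) (hq : q ∈ closure Ω) (hqp : q ≠ p)
    {u : EuclideanSpace ℝ (Fin n) → ℝ} {u' : EuclideanSpace ℝ (Fin n) →L[ℝ] ℝ}
    (hu : HasFDerivWithinAt u u' (closure Ω) p) (hu' : u' ν = 0)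
    {ψ : ℝ → ℝ} {ψ' : ℝ} (hψ : HasDerivWithinAt ψ ψ' (Icc 0 (Metric.diam Ω / 2)) (‖p - q‖ / 2))
    (hψ' : 0 < ψ') :
    ¬ ∀ p' ∈ closure Ω, u p' - 2 * ψ (‖p' - q‖ / 2) ≤ u p - 2 * ψ (‖p - q‖ / 2) := by
  intro hmax
  have hmaps : MapsTo (fun x => ‖x - q‖ / 2) (closure Ω) (Icc 0 (Metric.diam Ω / 2)) := by
    intro x hx
    have := Metric.dist_le_diam_of_mem hbdd.closure hx hq
    rw [Metric.diam_closure, dist_eq_norm] at this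
    exact ⟨by positivity, by linarith⟩
  have hd := hu.sub (((hψ.comp_hasFDerivWithinAt p
    (hasFDerivAt_half_norm_sub hqp.symm).hasFDerivWithinAt hmaps)).const_mul 2)
  have hloc : IsLocalMaxOn (u - fun x => 2 * (ψ ∘ fun x => ‖x - q‖ / 2) x) (closure Ω) p :=
    IsMaxOn.localize hmax
  have hle := hloc.hasFDerivWithinAt_nonpos hd (hν.neg_mem_posTangentConeAt hΩ.isOpen)
  have hpos : 0 < ψ' * (‖p - q‖⁻¹ * inner ℝ (p - q) ν) := by
    have := hΩ.inner_normal_pos hν hq hqp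
    have : 0 < ‖p - q‖ := norm_pos_iff.2 (sub_ne_zero.2 hqp.symm)
    positivity
  simp [hu', inner_sub_left] at hle hpos
  linarith

/-- Points of an open set do not realise its diameter. -/
theorem norm_sub_lt_diam_of_isOpen (ho : IsOpen Ω) (hbdd : Bornology.IsBounded Ω)
    {x y : EuclideanSpace ℝ (Fin n)} (hx : x ∈ Ω) (hy : y ∈ Ω) (hxy : x ≠ y) :
    ‖y - x‖ < Metric.diam Ω := by
  have hpos : 0 < ‖y - x‖ := norm_pos_iff.2 (sub_ne_zero.2 hxy.symm)
  obtain ⟨s, hs, hspos⟩ : ∃ s : ℝ, y + s • (y - x) ∈ Ω ∧ 0 < s := by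
    have hc : ContinuousAt (fun s : ℝ => y + s • (y - x)) 0 := by fun_prop
    have := hc.eventually (ho.mem_nhds (by simpa using hy))
    exact ((this.filter_mono (nhdsWithin_le_nhds (s := Ioi 0))).and self_mem_nhdsWithin).exists
  have hle := Metric.dist_le_diam_of_mem hbdd hs hx
  have heq : y + s • (y - x) - x = (1 + s) • (y - x) := by module
  rw [dist_eq_norm, heq, norm_smul, Real.norm_of_nonneg (by linarith)] at hle
  nlinarith

/-! ### Regularity of the solution -/

namespace IsNeumannDriftSolution

variable {X : EuclideanSpace ℝ (Fin n) → ℝ → EuclideanSpace ℝ (Fin n)}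
  {v : EuclideanSpace ℝ (Fin n) → ℝ → ℝ}

theorem contDiffOn_space (hv : IsNeumannDriftSolution Ω X v) {t : ℝ} (ht : 0 ≤ t) :
    ContDiffOn ℝ (⊤ : ℕ∞) (fun x => v x t) (closure Ω) :=
  hv.smooth.comp (f := fun x => (x, t)) (by fun_prop) fun _ hx => ⟨hx, ht⟩

theorem contDiffAt_space (hv : IsNeumannDriftSolution Ω X v) (ho : IsOpen Ω) {t : ℝ}
    (ht : 0 ≤ t) {x : EuclideanSpace ℝ (Fin n)} (hx : x ∈ Ω) :
    ContDiffAt ℝ 2 (fun x => v x t) x :=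
  (((hv.contDiffOn_space ht).mono subset_closure).contDiffAt (ho.mem_nhds hx)).of_le
    (WithTop.coe_le_coe.2 (le_top : (2 : ℕ∞) ≤ ⊤))

theorem differentiableOn_time (hv : IsNeumannDriftSolution Ω X v)
    {x : EuclideanSpace ℝ (Fin n)} (hx : x ∈ closure Ω) :
    DifferentiableOn ℝ (fun t => v x t) (Ici 0) :=
  (hv.smooth.comp (f := fun t => (x, t)) (by fun_prop) fun _ ht => ⟨hx, ht⟩).differentiableOn
    (by simp)

end IsNeumannDriftSolution

end Domain

/-! ### The first touching time -/

/-- A continuous function on `K × [0, T]`, `K` compact, that is negative at `t = 0` and not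
everywhere negative has a first zero, at which it is maximal both over `K` and over earlier
times. -/
theorem exists_first_zero {A : Type*} [TopologicalSpace A] [T2Space A] {K : Set A} (hK : IsCompact K)
    {F : A → ℝ → ℝ} (hF : ContinuousOn (fun p : A × ℝ => F p.1 p.2) (K ×ˢ Ici 0))
    (h₀ : ∀ a ∈ K, F a 0 < 0) {a₁ : A} {t₁ : ℝ} (ha₁ : a₁ ∈ K) (ht₁ : 0 ≤ t₁)
    (h₁ : 0 ≤ F a₁ t₁) :
    ∃ a ∈ K, ∃ t : ℝ, 0 < t ∧ F a t = 0 ∧ (∀ a' ∈ K, F a' t ≤ 0) ∧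
      ∀ s ∈ Icc 0 t, F a s ≤ 0 := by
  have hF' : ContinuousOn (fun p : A × ℝ => F p.1 p.2) (K ×ˢ Icc 0 t₁) :=
    hF.mono (prod_mono_right Icc_subset_Ici_self)
  have hKT : IsCompact (K ×ˢ Icc 0 t₁) := hK.prod isCompact_Icc
  have hScomp : IsCompact {p ∈ K ×ˢ Icc 0 t₁ | 0 ≤ F p.1 p.2} :=
    hKT.of_isClosed_subset (hF'.preimage_isClosed_of_isClosed hKT.isClosed isClosed_Ici)
      inter_subset_left
  obtain ⟨⟨a, t⟩, ⟨⟨ha, ht⟩, hat⟩, hmin⟩ := hScomp.exists_isMinOn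
    ⟨(a₁, t₁), ⟨ha₁, right_mem_Icc.2 ht₁⟩, h₁⟩ continuous_snd.continuousOn
  have hneg : ∀ a' ∈ K, ∀ s ∈ Ico 0 t, F a' s < 0 := by
    intro a' ha' s hs
    by_contra! h
    exact hs.2.not_ge (hmin (a := (a', s)) ⟨⟨ha', hs.1, hs.2.le.trans ht.2⟩, h⟩)
  have htpos : 0 < t := by
    refine ht.1.lt_of_ne fun h => ?_
    subst h
    exact (h₀ a ha).not_ge hat
  have hle : ∀ a' ∈ K, F a' t ≤ 0 := by
    intro a' ha'
    have hc : ContinuousOn (fun s => F a' s) (closure (Ico 0 t)) := by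
      rw [closure_Ico htpos.ne]
      exact hF.comp (f := fun s => (a', s)) (by fun_prop) fun s hs => ⟨ha', hs.1⟩
    refine le_on_closure (fun s hs => (hneg a' ha' s hs).le) hc continuousOn_const ?_
    rw [closure_Ico htpos.ne]
    exact right_mem_Icc.2 htpos.le
  refine ⟨a, ha, t, htpos, le_antisymm (hle a ha) hat, hle, fun s hs => ?_⟩
  rcases hs.2.eq_or_lt with rfl | h
  · exact hle a ha
  · exact (hneg a ha s ⟨hs.1, h⟩).le

/-! ### The maximum principle for the two-point function -/

section TwoPoint

variable {n : ℕ} {Ω : Set (EuclideanSpace ℝ (Fin n))}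

/-- A continuous modulus of continuity on `Ω` extends to the closure by density. -/
theorem IsModulusOfContinuity.le_on_closure {η : ℝ → ℝ} {f : EuclideanSpace ℝ (Fin n) → ℝ}
    (h : IsModulusOfContinuity Ω η f) (hbdd : Bornology.IsBounded Ω)
    (hη : ContinuousOn η (Icc 0 (Metric.diam Ω / 2))) (hf : ContinuousOn f (closure Ω))
    {x y : EuclideanSpace ℝ (Fin n)} (hx : x ∈ closure Ω) (hy : y ∈ closure Ω) :
    f y - f x ≤ 2 * η (‖y - x‖ / 2) := by
  have hmem : (x, y) ∈ closure (Ω ×ˢ Ω) := by rw [closure_prod_eq]; exact ⟨hx, hy⟩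
  refine _root_.le_on_closure (s := Ω ×ˢ Ω) (f := fun p => f p.2 - f p.1)
    (g := fun p => 2 * η (‖p.2 - p.1‖ / 2))
    (fun p hp => (le_abs_self _).trans (h p.1 hp.1 p.2 hp.2)) ?_ ?_ hmem
  · rw [closure_prod_eq]
    exact (hf.comp continuousOn_snd fun p hp => hp.2).sub
      (hf.comp continuousOn_fst fun p hp => hp.1)
  · rw [closure_prod_eq]
    refine continuousOn_const.mul (hη.comp (by fun_prop) fun p hp => ?_)
    have := Metric.dist_le_diam_of_mem hbdd.closure hp.2 hp.1
    rw [Metric.diam_closure, dist_eq_norm] at this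
    exact ⟨by positivity, by linarith⟩

/-- The two points of a maximum of `f y - f x - 2 ψ (|y - x| / 2)` over `closure Ω × closure Ω`
are interior, if they are distinct, `ψ' > 0` there, and `f` has zero normal derivative. -/
theorem IsStrictlyConvexDomain.mem_of_isMaxOn_two_point (hΩ : IsStrictlyConvexDomain Ω)
    (hbdd : Bornology.IsBounded Ω) (hsmooth : HasSmoothBoundary Ω)
    {f : EuclideanSpace ℝ (Fin n) → ℝ} (hf : DifferentiableOn ℝ f (closure Ω))
    (hneu : ∀ p ν, IsOutwardUnitNormal Ω p ν → fderivWithin ℝ f (closure Ω) p ν = 0)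
    {x y : EuclideanSpace ℝ (Fin n)} (hx : x ∈ closure Ω) (hy : y ∈ closure Ω) (hxy : x ≠ y)
    {ψ : ℝ → ℝ} {ψ' : ℝ} (hψ : HasDerivWithinAt ψ ψ' (Icc 0 (Metric.diam Ω / 2)) (‖y - x‖ / 2))
    (hψ' : 0 < ψ')
    (hmax : ∀ x' ∈ closure Ω, ∀ y' ∈ closure Ω,
      f y' - f x' - 2 * ψ (‖y' - x'‖ / 2) ≤ f y - f x - 2 * ψ (‖y - x‖ / 2)) :
    x ∈ Ω ∧ y ∈ Ω := by
  have hfr : ∀ p ∈ closure Ω, p ∉ Ω → ∃ ν, IsOutwardUnitNormal Ω p ν := by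
    intro p hp hpΩ
    have hpf : p ∈ frontier Ω := by rw [hΩ.isOpen.frontier_eq]; exact ⟨hp, hpΩ⟩
    obtain ⟨ρ, hρ⟩ := hsmooth p hpf
    exact ⟨_, hpf, ρ, hρ, rfl⟩
  constructor <;> by_contra hout
  · obtain ⟨ν, hν⟩ := hfr x hx hout
    refine hΩ.not_isMaxOn_sub_of_neumann hbdd hν hy hxy.symm (hf x hx).hasFDerivWithinAt.neg
      (by simp [hneu x ν hν]) (by rwa [norm_sub_rev]) hψ' fun x' hx' => ?_
    have := hmax x' hx' y hy
    rw [norm_sub_rev x', norm_sub_rev x]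
    simp only [Pi.neg_apply]
    linarith
  · obtain ⟨ν, hν⟩ := hfr y hy hout
    refine hΩ.not_isMaxOn_sub_of_neumann hbdd hν hx hxy (hf y hy).hasFDerivWithinAt
      (hneu y ν hν) hψ hψ' fun y' hy' => ?_
    have := hmax x hx y' hy'
    linarith

/-- At an interior maximum of the two-point function of a solution, the difference of the time
derivatives is controlled by the operator of the one-dimensional equation. -/
theorem IsNeumannDriftSolution.derivWithin_sub_le
    {X : EuclideanSpace ℝ (Fin n) → ℝ → EuclideanSpace ℝ (Fin n)}
    {v : EuclideanSpace ℝ (Fin n) → ℝ → ℝ} (hv : IsNeumannDriftSolution Ω X v) (ho : IsOpen Ω)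
    {t : ℝ} (ht : 0 ≤ t) {ω : ℝ → ℝ} (hX : IsModulusOfContraction Ω ω (fun x => X x t))
    {x y : EuclideanSpace ℝ (Fin n)} (hx : x ∈ Ω) (hy : y ∈ Ω) (hxy : x ≠ y)
    {ψ ψ' : ℝ → ℝ} {ψ'' : ℝ}
    (hψ : ∀ᶠ z in 𝓝 (‖y - x‖ / 2), HasDerivAt ψ (ψ' z) z)
    (hψ' : HasDerivAt ψ' ψ'' (‖y - x‖ / 2)) (hpos : 0 < ψ' (‖y - x‖ / 2))
    (hmax : ∀ x' ∈ Ω, ∀ y' ∈ Ω, v y' t - v x' t - 2 * ψ (‖y' - x'‖ / 2)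
      ≤ v y t - v x t - 2 * ψ (‖y - x‖ / 2)) :
    derivWithin (fun s => v y s) (Ici 0) t - derivWithin (fun s => v x s) (Ici 0) t
      ≤ 2 * (ψ'' + ω (‖y - x‖ / 2) * ψ' (‖y - x‖ / 2)) := by
  have hcx := hv.contDiffAt_space ho ht hx
  have hcy := hv.contDiffAt_space ho ht hy
  obtain ⟨hgy, hgx⟩ := fderiv_eq_of_isMaxOn_two_point (f := fun z => v z t) ho hx hy hxy
    (hcx.differentiableAt (by simp)) (hcy.differentiableAt (by simp)) hψ.self_of_nhds hmax
  have hlap := laplacian_sub_le_of_isMaxOn_two_point (f := fun z => v z t) ho hx hy hxy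
    hcx hcy hψ hψ' hmax
  have hcontr := hX x hx y hy hxy.symm
  simp only [neg_sub_neg] at hcontr
  rw [hv.equation x hx t ht, hv.equation y hy t ht, inner_gradient_right, inner_gradient_right,
    hgy, hgx]
  rw [inner_sub_left, real_inner_comm, real_inner_comm _ (X y t)] at hcontr
  simp only [conj_trivial]
  nlinarith

end TwoPoint

theorem theorem2p1 {n : ℕ} (Ω : Set (EuclideanSpace ℝ (Fin n))) (D : ℝ)
    (hΩ : IsStrictlyConvexDomain Ω) (hbdd : Bornology.IsBounded Ω)
    (hsmooth : HasSmoothBoundary Ω) (hD : Metric.diam Ω = D)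
    (X : EuclideanSpace ℝ (Fin n) → ℝ → EuclideanSpace ℝ (Fin n))
    (v : EuclideanSpace ℝ (Fin n) → ℝ → ℝ) (hv : IsNeumannDriftSolution Ω X v)
    (ω : ℝ → ℝ → ℝ)
    (hω : ContDiffOn ℝ (⊤ : ℕ∞) (fun p : ℝ × ℝ => ω p.1 p.2) (Icc 0 (D / 2) ×ˢ Ici 0))
    (hX : ∀ t : ℝ, 0 ≤ t → IsModulusOfContraction Ω (fun z => ω z t) (fun x => X x t))
    (φ₀ : ℝ → ℝ) (hφ₀ : ContDiffOn ℝ (⊤ : ℕ∞) φ₀ (Icc 0 (D / 2))) (hφ₀_zero : φ₀ 0 = 0)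
    (hφ₀_deriv : ∀ z ∈ Icc 0 (D / 2), 0 < derivIcc (D / 2) φ₀ z)
    (hv₀ : IsModulusOfContinuity Ω φ₀ (fun x => v x 0))
    (φ : ℝ → ℝ → ℝ)
    -- the derivatives of `φ` that occur below exist
    (hφ_t : ∀ z ∈ Icc 0 (D / 2), DifferentiableOn ℝ (fun s => φ z s) (Ici 0))
    (hφ_z : ∀ t : ℝ, 0 ≤ t → DifferentiableOn ℝ (fun w => φ w t) (Icc 0 (D / 2)))
    (hφ_zz : ∀ t : ℝ, 0 ≤ t →
      DifferentiableOn ℝ (derivIcc (D / 2) (fun w => φ w t)) (Icc 0 (D / 2)))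
    (hφ_init : ∀ z ∈ Icc 0 (D / 2), φ z 0 = φ₀ z)
    (hφ_ineq : ∀ z ∈ Icc 0 (D / 2), ∀ t : ℝ, 0 ≤ t →
      derivIcc (D / 2) (derivIcc (D / 2) (fun w => φ w t)) z
        + ω z t * derivIcc (D / 2) (fun w => φ w t) z
        ≤ derivWithin (fun s => φ z s) (Ici 0) t)
    (hφ_pos : ∀ z ∈ Icc 0 (D / 2), ∀ t : ℝ, 0 ≤ t → 0 < derivIcc (D / 2) (fun w => φ w t) z)
    (hφ_zero : ∀ t : ℝ, 0 ≤ t → 0 ≤ φ 0 t) :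
    ∀ t : ℝ, 0 ≤ t → IsModulusOfContinuity Ω (fun z => φ z t) (fun x => v x t) := by
  subst hD
  have hφ_cont : ContinuousOn (fun p : ℝ × ℝ => φ p.1 p.2)
      (Icc 0 (Metric.diam Ω / 2) ×ˢ Ici 0) :=
    continuousOn_uncurry_of_monotoneOn
      (fun t ht => monotoneOn_Icc_of_derivIcc_pos (hφ_z t ht) fun z hz => hφ_pos z hz t ht)
      (fun t ht => (hφ_z t ht).continuousOn) fun z hz => (hφ_t z hz).continuousOn
  have hdist : ∀ x ∈ closure Ω, ∀ y ∈ closure Ω, ‖y - x‖ / 2 ∈ Icc 0 (Metric.diam Ω / 2) := by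
    intro x hx y hy
    have := Metric.dist_le_diam_of_mem hbdd.closure hy hx
    rw [Metric.diam_closure, dist_eq_norm] at this
    exact ⟨by positivity, by linarith⟩
  have key : ∀ ε > 0, ∀ x ∈ closure Ω, ∀ y ∈ closure Ω, ∀ t : ℝ, 0 ≤ t →
      v y t - v x t - 2 * φ (‖y - x‖ / 2) t - ε * (1 + t) < 0 := by
    intro ε hε x₁ hx₁ y₁ hy₁ t₁ ht₁
    by_contra! hcon
    let F : EuclideanSpace ℝ (Fin n) × EuclideanSpace ℝ (Fin n) → ℝ → ℝ := fun p t =>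
      v p.2 t - v p.1 t - 2 * φ (‖p.2 - p.1‖ / 2) t - ε * (1 + t)
    have hF : ContinuousOn
        (fun q : (EuclideanSpace ℝ (Fin n) × EuclideanSpace ℝ (Fin n)) × ℝ => F q.1 q.2)
        ((closure Ω ×ˢ closure Ω) ×ˢ Ici 0) := by
      have hvc := hv.smooth.continuousOn
      refine ((ContinuousOn.sub ?_ ?_).sub (continuousOn_const.mul ?_)).sub (by fun_prop)
      · exact hvc.comp (f := fun q : (_ × _) × ℝ => (q.1.2, q.2)) (by fun_prop)
          fun q hq => ⟨hq.1.2, hq.2⟩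
      · exact hvc.comp (f := fun q : (_ × _) × ℝ => (q.1.1, q.2)) (by fun_prop)
          fun q hq => ⟨hq.1.1, hq.2⟩
      · exact hφ_cont.comp (f := fun q : (_ × _) × ℝ => (‖q.1.2 - q.1.1‖ / 2, q.2))
          (by fun_prop) fun q hq => ⟨hdist _ hq.1.1 _ hq.1.2, hq.2⟩
    have hF₀ : ∀ p ∈ closure Ω ×ˢ closure Ω, F p 0 < 0 := by
      rintro ⟨x, y⟩ ⟨hx, hy⟩
      have := hv₀.le_on_closure hbdd hφ₀.continuousOn (hv.contDiffOn_space le_rfl).continuousOn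
        hx hy
      simp only [F, hφ_init _ (hdist x hx y hy)]
      linarith
    obtain ⟨⟨x, y⟩, ⟨hx, hy⟩, t, ht, hzero, hspace, htime⟩ := exists_first_zero
      (hbdd.isCompact_closure.prod hbdd.isCompact_closure) hF hF₀ (a₁ := (x₁, y₁))
      ⟨hx₁, hy₁⟩ ht₁ hcon
    replace hx : x ∈ closure Ω := hx
    replace hy : y ∈ closure Ω := hy
    have hxy : x ≠ y := by
      rintro rfl
      simp only [F, sub_self, norm_zero, zero_div] at hzero
      have := hφ_zero t ht.le
      have : 0 < ε * (1 + t) := by positivity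
      linarith
    have hmax : ∀ x' ∈ closure Ω, ∀ y' ∈ closure Ω, v y' t - v x' t - 2 * φ (‖y' - x'‖ / 2) t
        ≤ v y t - v x t - 2 * φ (‖y - x‖ / 2) t := by
      intro x' hx' y' hy'
      have := hspace (x', y') ⟨hx', hy'⟩
      simp only [F] at this hzero
      linarith
    have hz := hdist x hx y hy
    obtain ⟨hxΩ, hyΩ⟩ := hΩ.mem_of_isMaxOn_two_point (f := fun x => v x t) (ψ := fun z => φ z t)
      hbdd hsmooth ((hv.contDiffOn_space ht.le).differentiableOn (by simp))
      (fun p ν hν => hv.neumann p ν hν t ht.le) hx hy hxy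
      (hφ_z t ht.le _ hz).hasDerivWithinAt (hφ_pos _ hz t ht.le) hmax
    -- for interior points `‖y - x‖ / 2` is interior to `[0, D / 2]`, and the one-sided derivatives
    -- of `φ` in `z` are two-sided
    have hIoo : ‖y - x‖ / 2 ∈ Ioo 0 (Metric.diam Ω / 2) := by
      have h₁ := norm_sub_lt_diam_of_isOpen hΩ.isOpen hbdd hxΩ hyΩ hxy
      have h₂ : 0 < ‖y - x‖ := norm_pos_iff.2 (sub_ne_zero.2 hxy.symm)
      exact ⟨by linarith, by linarith⟩
    have hpde := hv.derivWithin_sub_le hΩ.isOpen ht.le (hX t ht.le) hxΩ hyΩ hxy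
      (ψ := fun z => φ z t) (ψ' := derivIcc (Metric.diam Ω / 2) fun z => φ z t)
      (ψ'' := derivIcc (Metric.diam Ω / 2) (derivIcc (Metric.diam Ω / 2) fun z => φ z t)
        (‖y - x‖ / 2))
      (by
        filter_upwards [Ioo_mem_nhds hIoo.1 hIoo.2] with z hz
        exact (hφ_z t ht.le z (Ioo_subset_Icc_self hz)).hasDerivWithinAt.hasDerivAt
          (Icc_mem_nhds hz.1 hz.2))
      ((hφ_zz t ht.le _ hz).hasDerivWithinAt.hasDerivAt (Icc_mem_nhds hIoo.1 hIoo.2))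
      (hφ_pos _ hz t ht.le)
      (fun x' hx' y' hy' => hmax x' (subset_closure hx') y' (subset_closure hy'))
    have hdt : HasDerivAt (F (x, y)) (derivWithin (fun s => v y s) (Ici 0) t
        - derivWithin (fun s => v x s) (Ici 0) t
        - 2 * derivWithin (fun s => φ (‖y - x‖ / 2) s) (Ici 0) t - ε * 1) t := by
      have hnhds : Ici 0 ∈ 𝓝 t := Ici_mem_nhds ht
      exact ((((hv.differentiableOn_time hy t ht.le).hasDerivWithinAt.hasDerivAt hnhds).sub
        ((hv.differentiableOn_time hx t ht.le).hasDerivWithinAt.hasDerivAt hnhds)).sub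
        (((hφ_t _ hz t ht.le).hasDerivWithinAt.hasDerivAt hnhds).const_mul 2)).sub
        (((hasDerivAt_id t).const_add 1).const_mul ε)
    have hnonneg := hasDerivAt_nonneg_of_forall_le_left ht hdt
      fun s hs => (htime s hs).trans hzero.ge
    have hsuper := hφ_ineq _ hz t ht.le
    linarith
  have hle : ∀ x ∈ Ω, ∀ y ∈ Ω, ∀ t : ℝ, 0 ≤ t → v y t - v x t ≤ 2 * φ (‖y - x‖ / 2) t := by
    intro x hx y hy t ht
    refine le_of_forall_pos_le_add fun δ hδ => ?_
    have hpos : 0 < 1 + t := by linarith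
    have := key (δ / (1 + t)) (by positivity) x (subset_closure hx) y (subset_closure hy) t ht
    rw [div_mul_cancel₀ _ hpos.ne'] at this
    linarith
  intro t ht x hx y hy
  refine abs_le'.2 ⟨hle x hx y hy t ht, ?_⟩
  have := hle y hy x hx t ht
  rw [norm_sub_rev] at this
  simp only [neg_sub]
  exact this
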